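/- Let $M$ be a connected, Hausdorff, second countable $C^\infty$ manifold without boundary, of dimension $n$, and let $r,m\ge 0$ be integers. Let $F^r(M)\to M$ be the $r$-th order frame bundle of $M$, i.e. the set of $r$-jets $j^r_0\xi$ at $0$ of smooth maps $\xi$ from a neighbourhood of $0$ in $\mathbb{R}^n$ to $M$ whose differential at $0$ is a linear isomorphism, with projection $j^r_0\xi\mapsto\xi(0)$. It is a principal bundle, under composition of jets, whose structure group is the jet group $G^r(n)$: the Lie group of $r$-jets $j^r_0f$ at $0$ of smooth maps $f$ from a neighbourhood of $0$ in $\mathbb{R}^n$ to $\mathbb{R}^n$ such that $f(0)=0$ and the differential of $f$ at $0$ is a linear isomorphism. (For $r=0$, $F^0(M)=M$ and $G^0(n)$ is trivial.) Let $\lambda\colon G^r(n)\to Gl(m,\mathbb{R})$ be a linear representation (a smooth group homomorphism), and let $p\colon V=F^r(M)\times^{G^r(n)}\mathbb{R}^m\to M$ be the vector bundle associated with $F^r(M)$ through $\lambda$. Let $\mathrm{AUT}\,V$ be the group of automorphisms of $V$, i.e. of the diffeomorphisms $\Phi\colon V\to V$ that map every fibre $V_x$ linearly onto some fibre $V_{x'}$,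 let $\mathrm{Diff}\,M$ be the group of $C^\infty$ diffeomorphisms of $M$, and let $h_V\colon\mathrm{AUT}\,V\to\mathrm{Diff}\,M$ be the group homomorphism that sends $\Phi$ to the diffeomorphism $\varphi$ with $\Phi(V_x)=V_{\varphi(x)}$ for all $x\in M$. Then $h_V$ is surjective; that is, every diffeomorphism $\varphi$ of $M$ lifts to an automorphism $\Phi$ of $V$ with $h_V(\Phi)=\varphi$. -/

import Mathlib

open scoped Manifold ContDiff Topology
open Set Filter Bundle

noncomputable section

namespace JetBundle

section Jets

variable {E F G : Type*} [NormedAddCommGroup E] [NormedSpace ℝ E] [NormedAddCommGroup F]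
  [NormedSpace ℝ F] [NormedAddCommGroup G] [NormedSpace ℝ G]

/-- Two maps have the same `r`-jet at `0`: their derivatives of order `≤ r` at `0` agree. -/
def SameJet (r : ℕ) (f g : E → F) : Prop :=
  ∀ k ≤ r, iteratedFDeriv ℝ k f 0 = iteratedFDeriv ℝ k g 0

theorem SameJet.symm {r : ℕ} {f g : E → F} (h : SameJet r f g) : SameJet r g f :=
  fun k hk => (h k hk).symm

theorem SameJet.trans {r : ℕ} {f g h : E → F} (h₁ : SameJet r f g) (h₂ : SameJet r g h) :
    SameJet r f h := fun k hk => (h₁ k hk).trans (h₂ k hk)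

theorem SameJet.of_eventuallyEq {r : ℕ} {f g : E → F} (h : f =ᶠ[𝓝 0] g) : SameJet r f g :=
  fun k _ => (h.iteratedFDeriv ℝ k).eq_of_nhds

theorem SameJet.comp {r : ℕ} {f f' : E → F} {g g' : F → G} (h0 : f 0 = 0) (h0' : f' 0 = 0)
    (hf : ContDiffAt ℝ ∞ f 0) (hf' : ContDiffAt ℝ ∞ f' 0)
    (hg : ContDiffAt ℝ ∞ g 0) (hg' : ContDiffAt ℝ ∞ g' 0)
    (h₁ : SameJet r g g') (h₂ : SameJet r f f') :
    SameJet r (g ∘ f) (g' ∘ f') := by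
  intro k hk
  have hk' : ((k : ℕ) : ℕ∞ω) ≤ ∞ := by exact_mod_cast le_top
  rw [iteratedFDeriv_comp (n := ∞) (by rwa [h0]) hf hk',
    iteratedFDeriv_comp (n := ∞) (by rwa [h0']) hf' hk', h0, h0']
  simp only [FormalMultilinearSeries.taylorComp]
  refine Finset.sum_congr rfl fun c _ => ?_
  ext v
  simp only [FormalMultilinearSeries.compAlongOrderedFinpartition_apply, ftaylorSeries]
  rw [h₁ _ (c.length_le.trans hk)]
  congr 1
  ext i
  simp only [OrderedFinpartition.applyOrderedFinpartition_apply]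
  rw [h₂ _ ((c.partSize_le i).trans hk)]

theorem iteratedFDeriv_sub_const_succ (f : E → F) (c : F) (k : ℕ) (x : E) :
    iteratedFDeriv ℝ (k + 1) (fun y => f y - c) x = iteratedFDeriv ℝ (k + 1) f x := by
  have h : fderiv ℝ (fun y => f y - c) = fderiv ℝ f := by
    ext1 y
    exact fderiv_sub_const c
  rw [iteratedFDeriv_succ_eq_comp_right, iteratedFDeriv_succ_eq_comp_right, h]

theorem SameJet.sub_const {r : ℕ} {f g : E → F} (h : SameJet r f g) (c : F) :
    SameJet r (fun y => f y - c) (fun y => g y - c) := by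
  intro k hk
  cases k with
  | zero =>
    have := h 0 hk
    ext v
    have := congrArg (fun a => a v) this
    simpa using this
  | succ k => rw [iteratedFDeriv_sub_const_succ, iteratedFDeriv_sub_const_succ, h _ hk]

theorem SameJet.eq_zero {r : ℕ} {f g : E → F} (h : SameJet r f g) : f 0 = g 0 := by
  have := congrArg (fun a => a (fun _ => 0)) (h 0 (Nat.zero_le r))
  simpa using this

end Jets

section JetGroup

variable (E : Type*) [NormedAddCommGroup E] [NormedSpace ℝ E]

/-- Representatives of the elements of the jet groups: maps `f : E → E`, smooth near `0`,
with `f 0 = 0` and invertible derivative at `0`. -/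
structure DiffeoGerm where
  toFun : E → E
  map_zero : toFun 0 = 0
  smooth : ∀ᶠ y in 𝓝 (0 : E), ContDiffAt ℝ ∞ toFun y
  invertible : (fderiv ℝ toFun 0).IsInvertible

variable {E}

namespace DiffeoGerm

/-- The identity. -/
def id : DiffeoGerm E where
  toFun := _root_.id
  map_zero := rfl
  smooth := Eventually.of_forall fun _ => contDiffAt_id
  invertible := by
    rw [fderiv_id]
    exact ⟨ContinuousLinearEquiv.refl ℝ E, rfl⟩

theorem contDiffAt (f : DiffeoGerm E) : ContDiffAt ℝ ∞ f.toFun 0 := f.smooth.self_of_nhds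

theorem differentiableAt (f : DiffeoGerm E) : DifferentiableAt ℝ f.toFun 0 :=
  f.contDiffAt.differentiableAt (by simp)

theorem tendsto (f : DiffeoGerm E) : Tendsto f.toFun (𝓝 0) (𝓝 0) := by
  have := f.contDiffAt.continuousAt
  rwa [ContinuousAt, f.map_zero] at this

/-- Composition `f ∘ g`. -/
def comp (f g : DiffeoGerm E) : DiffeoGerm E where
  toFun := f.toFun ∘ g.toFun
  map_zero := by simp [g.map_zero, f.map_zero]
  smooth := by
    filter_upwards [g.smooth, g.tendsto.eventually f.smooth] with y h₁ h₂
    exact ContDiffAt.comp y h₂ h₁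
  invertible := by
    rw [fderiv_comp _ (by rw [g.map_zero]; exact f.differentiableAt) g.differentiableAt,
      g.map_zero]
    exact f.invertible.comp g.invertible

theorem exists_left_inv [CompleteSpace E] (f : DiffeoGerm E) :
    ∃ g : DiffeoGerm E, ∀ᶠ y in 𝓝 (0 : E), g.toFun (f.toFun y) = y := by
  obtain ⟨f', hf'⟩ := f.invertible
  have hd : HasFDerivAt f.toFun (f' : E →L[ℝ] E) 0 := by
    rw [hf']; exact f.differentiableAt.hasFDerivAt
  let e := f.contDiffAt.toOpenPartialHomeomorph f.toFun hd (by simp)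
  have he : ∀ y, e y = f.toFun y := fun y => rfl
  have h0 : (0 : E) ∈ e.source := f.contDiffAt.mem_toOpenPartialHomeomorph_source hd (by simp)
  have h0' : (0 : E) ∈ e.target := by
    have := e.map_source h0
    rwa [he, f.map_zero] at this
  have hs0 : e.symm 0 = 0 := by
    have := e.left_inv h0
    rwa [he, f.map_zero] at this
  have hc : Tendsto e.symm (𝓝 0) (𝓝 0) := by
    have := e.continuousAt_symm h0'
    rwa [ContinuousAt, hs0] at this
  have hinv : ∀ᶠ y in 𝓝 (0 : E), ∃ A : E ≃L[ℝ] E, (A : E →L[ℝ] E) = fderiv ℝ f.toFun y := by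
    have h1 : ContinuousAt (fderiv ℝ f.toFun) 0 :=
      (f.contDiffAt.fderiv_right (m := 0) (by simp)).continuousAt
    refine h1.eventually (ContinuousLinearEquiv.isOpen.mem_nhds ?_)
    exact ⟨f', hf'⟩
  have hsm : ∀ᶠ y in 𝓝 (0 : E), ContDiffAt ℝ ∞ e.symm y := by
    filter_upwards [hc.eventually f.smooth, hc.eventually hinv, e.open_target.mem_nhds h0']
      with y h1 h2 h3
    obtain ⟨A, hA⟩ := h2
    refine e.contDiffAt_symm (f₀' := A) h3 ?_ h1
    rw [hA]
    exact (h1.differentiableAt (by simp)).hasFDerivAt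
  have hsd : HasFDerivAt e.symm (f'.symm : E →L[ℝ] E) 0 :=
    e.hasFDerivAt_symm h0' (by rw [hs0]; exact hd)
  refine ⟨⟨e.symm, hs0, hsm, ?_⟩, ?_⟩
  · rw [hsd.fderiv]
    exact ⟨f'.symm, rfl⟩
  · filter_upwards [e.open_source.mem_nhds h0] with y hy
    exact e.left_inv hy

end DiffeoGerm

/-- Equality of `r`-jets at `0`. -/
@[reducible] def jetSetoid (r : ℕ) (E : Type*) [NormedAddCommGroup E] [NormedSpace ℝ E] :
    Setoid (DiffeoGerm E) where
  r f g := SameJet r f.toFun g.toFun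
  iseqv := ⟨fun _ _ _ => rfl, SameJet.symm, SameJet.trans⟩

/-- The jet group `Gʳ(E)`: `r`-jets at `0` of maps `f : E → E` with `f 0 = 0` that are smooth near
`0` and have invertible derivative at `0`. For `E = ℝⁿ` this is `Gʳ(n)`. -/
def JetGroup (r : ℕ) (E : Type*) [NormedAddCommGroup E] [NormedSpace ℝ E] : Type _ :=
  Quotient (jetSetoid r E)

namespace JetGroup

variable {r : ℕ}

/-- The `r`-jet at `0` of `f`. -/
def mk (r : ℕ) (f : DiffeoGerm E) : JetGroup r E := Quotient.mk (jetSetoid r E) f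

theorem mk_eq_mk {f g : DiffeoGerm E} : mk r f = mk r g ↔ SameJet r f.toFun g.toFun :=
  Quotient.eq (r := jetSetoid r E)

/-- The group law is composition of jets: `(j f) * (j g) = j (f ∘ g)`. -/
instance : Monoid (JetGroup r E) where
  mul := Quotient.map₂ DiffeoGerm.comp fun f f' h g g' h' =>
    SameJet.comp (f := g.toFun) (f' := g'.toFun) (g := f.toFun) (g' := f'.toFun) g.map_zero
      g'.map_zero g.contDiffAt g'.contDiffAt f.contDiffAt f'.contDiffAt h h'
  one := mk r DiffeoGerm.id
  mul_assoc := by rintro ⟨f⟩ ⟨g⟩ ⟨h⟩; rfl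
  one_mul := by rintro ⟨f⟩; rfl
  mul_one := by rintro ⟨f⟩; rfl

theorem mk_mul_mk (f g : DiffeoGerm E) : mk r f * mk r g = mk r (f.comp g) := rfl

theorem one_def : (1 : JetGroup r E) = mk r DiffeoGerm.id := rfl

variable [FiniteDimensional ℝ E]

theorem exists_left_inv (a : JetGroup r E) : ∃ b : JetGroup r E, b * a = 1 := by
  have : CompleteSpace E := FiniteDimensional.complete ℝ E
  obtain ⟨f⟩ := a
  obtain ⟨g, hg⟩ := f.exists_left_inv
  exact ⟨mk r g, mk_eq_mk.2 (SameJet.of_eventuallyEq hg)⟩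

instance : Group (JetGroup r E) :=
  { (inferInstance : Monoid (JetGroup r E)) with
    inv := fun a => Classical.choose (exists_left_inv a)
    inv_mul_cancel := fun a => Classical.choose_spec (exists_left_inv a) }

end JetGroup

/-- The vector space of `r`-jets at `0` of smooth maps `f : E → E` with `f 0 = 0`, an `r`-jet being
given by its derivatives `(D f(0), D² f(0), …, Dʳ f(0))`. -/
def JetSpace (r : ℕ) (E : Type*) [NormedAddCommGroup E] [NormedSpace ℝ E] :
    Submodule ℝ (∀ k : Fin r, E [×((k : ℕ) + 1)]→L[ℝ] E) where
  carrier := {a | ∃ f : E → E, f 0 = 0 ∧ (∀ᶠ y in 𝓝 (0 : E), ContDiffAt ℝ ∞ f y) ∧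
    ∀ k : Fin r, iteratedFDeriv ℝ ((k : ℕ) + 1) f 0 = a k}
  zero_mem' := ⟨fun _ => 0, rfl, Eventually.of_forall fun _ => contDiffAt_const, fun k => by simp⟩
  add_mem' := by
    rintro a b ⟨f, hf0, hf, hfa⟩ ⟨g, hg0, hg, hgb⟩
    refine ⟨f + g, by simp [hf0, hg0], by filter_upwards [hf, hg] with y h₁ h₂ using h₁.add h₂,
      fun k => ?_⟩
    rw [iteratedFDeriv_add_apply (hf.self_of_nhds.of_le (by exact_mod_cast le_top))
      (hg.self_of_nhds.of_le (by exact_mod_cast le_top)), hfa, hgb]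
    rfl
  smul_mem' := by
    rintro c a ⟨f, hf0, hf, hfa⟩
    refine ⟨c • f, by simp [hf0], by filter_upwards [hf] with y h₁ using contDiffAt_const.smul h₁,
      fun k => ?_⟩
    rw [iteratedFDeriv_const_smul_apply (hf.self_of_nhds.of_le (by exact_mod_cast le_top)), hfa]
    rfl

namespace JetGroup

variable {r : ℕ}

/-- The inclusion of the jet group into the space of jets. -/
def coords : JetGroup r E → JetSpace r E :=
  Quotient.lift (s := jetSetoid r E)
    (fun f => ⟨fun k => iteratedFDeriv ℝ ((k : ℕ) + 1) f.toFun 0,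
      f.toFun, f.map_zero, f.smooth, fun _ => rfl⟩)
    (fun _ _ h => Subtype.ext (funext fun k => h _ (Nat.succ_le_of_lt k.2)))

theorem coords_mk (f : DiffeoGerm E) (k : Fin r) :
    (coords (mk r f)).1 k = iteratedFDeriv ℝ ((k : ℕ) + 1) f.toFun 0 := rfl

theorem coords_injective : Function.Injective (coords : JetGroup r E → JetSpace r E) := by
  rintro ⟨f⟩ ⟨g⟩ h
  refine mk_eq_mk.2 fun k hk => ?_
  cases k with
  | zero => ext v; simp [f.map_zero, g.map_zero]
  | succ k => exact congrFun (congrArg Subtype.val h) ⟨k, hk⟩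

theorem isOpen_range_coords [FiniteDimensional ℝ E] :
    IsOpen (range (coords : JetGroup r E → JetSpace r E)) := by
  have : CompleteSpace E := FiniteDimensional.complete ℝ E
  cases r with
  | zero =>
    have : Subsingleton (JetSpace 0 E) := ⟨fun a b => Subtype.ext (funext fun k => k.elim0)⟩
    exact isOpen_discrete _
  | succ r =>
    let L : JetSpace (r + 1) E → (E →L[ℝ] E) := fun a =>
      continuousMultilinearCurryFin1 ℝ E E (a.1 0)
    have hL : Continuous L := (continuousMultilinearCurryFin1 ℝ E E).continuous.comp
      ((continuous_apply (0 : Fin (r + 1))).comp continuous_subtype_val)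
    have key : ∀ (f : E → E) (a : JetSpace (r + 1) E),
        (∀ k : Fin (r + 1), iteratedFDeriv ℝ ((k : ℕ) + 1) f 0 = a.1 k) → L a = fderiv ℝ f 0 := by
      intro f a h
      ext v
      change (a.1 0) (Fin.snoc 0 v) = _
      rw [← h 0]
      refine (iteratedFDeriv_one_apply (𝕜 := ℝ) (f := f) (x := 0) _).trans ?_
      rfl
    have : range (coords : JetGroup (r + 1) E → JetSpace (r + 1) E) =
        L ⁻¹' (range ((↑) : (E ≃L[ℝ] E) → (E →L[ℝ] E))) := by
      ext a
      constructor
      · rintro ⟨⟨f⟩, rfl⟩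
        obtain ⟨A, hA⟩ := f.invertible
        exact ⟨A, hA.trans (key f.toFun _ fun _ => rfl).symm⟩
      · rintro ⟨A, hA⟩
        obtain ⟨f, hf0, hf, hfa⟩ := a.2
        refine ⟨mk _ ⟨f, hf0, hf, A, hA.trans (key f a hfa)⟩, Subtype.ext (funext hfa)⟩
    rw [this]
    exact ContinuousLinearEquiv.isOpen.preimage hL

instance : TopologicalSpace (JetGroup r E) := .induced coords inferInstance

instance : Nonempty (JetGroup r E) := ⟨1⟩

theorem isOpenEmbedding_coords [FiniteDimensional ℝ E] :
    Topology.IsOpenEmbedding (coords : JetGroup r E → JetSpace r E) :=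
  ⟨⟨⟨rfl⟩, coords_injective⟩, isOpen_range_coords⟩

/-- The manifold structure on the jet group as an open subset of the space of jets. -/
instance [FiniteDimensional ℝ E] : ChartedSpace (JetSpace r E) (JetGroup r E) :=
  isOpenEmbedding_coords.singletonChartedSpace

instance [FiniteDimensional ℝ E] : IsManifold 𝓘(ℝ, JetSpace r E) ∞ (JetGroup r E) :=
  isOpenEmbedding_coords.isManifold_singleton

end JetGroup

end JetGroup

section Frames

variable {E : Type*} [NormedAddCommGroup E] [NormedSpace ℝ E]
  {M : Type*} [TopologicalSpace M] [ChartedSpace E M]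

variable (E) in
/-- Representatives of the frames of order `r` at `x`: maps `ξ : E → M`, smooth near `0`, with
`ξ 0 = x` and invertible differential at `0`. -/
structure FrameGerm (x : M) where
  toFun : E → M
  map_zero : toFun 0 = x
  smooth : ∀ᶠ y in 𝓝 (0 : E), ContMDiffAt 𝓘(ℝ, E) 𝓘(ℝ, E) ∞ toFun y
  invertible : (mfderiv 𝓘(ℝ, E) 𝓘(ℝ, E) toFun 0).IsInvertible

/-- Two maps `E → M` sending `0` to `x` have the same `r`-jet at `0`: so do their expressions in
the preferred chart at `x`. (The choice of the chart does not matter, see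
`FrameGerm.sameJet_chart`.) -/
@[reducible] def frameSetoid (r : ℕ) (x : M) : Setoid (FrameGerm E x) where
  r ξ η := SameJet r (chartAt E x ∘ ξ.toFun) (chartAt E x ∘ η.toFun)
  iseqv := ⟨fun _ _ _ => rfl, SameJet.symm, SameJet.trans⟩

variable (E) in
/-- The fibre `Fʳ(M)_x` of the frame bundle of order `r`: the `r`-jets at `0` of the maps
`ξ : E → M` with `ξ 0 = x` that are smooth near `0` and have invertible differential at `0`. So
`Fʳ(M)` is the disjoint union of these fibres and the projection `Fʳ(M) → M` is `j ξ ↦ ξ 0`. -/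
def FrameFiber (r : ℕ) (x : M) : Type _ := Quotient (frameSetoid (E := E) r x)

namespace FrameGerm

variable {x : M}

theorem contMDiffAt (ξ : FrameGerm E x) : ContMDiffAt 𝓘(ℝ, E) 𝓘(ℝ, E) ∞ ξ.toFun 0 :=
  ξ.smooth.self_of_nhds

theorem mdifferentiableAt (ξ : FrameGerm E x) : MDifferentiableAt 𝓘(ℝ, E) 𝓘(ℝ, E) ξ.toFun 0 :=
  ξ.contMDiffAt.mdifferentiableAt (by simp)

theorem tendsto (ξ : FrameGerm E x) : Tendsto ξ.toFun (𝓝 0) (𝓝 x) := by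
  have := ξ.contMDiffAt.continuousAt
  rwa [ContinuousAt, ξ.map_zero] at this

/-- The composition `ξ ∘ f`. -/
def comp (ξ : FrameGerm E x) (f : DiffeoGerm E) : FrameGerm E x where
  toFun := ξ.toFun ∘ f.toFun
  map_zero := by simp [f.map_zero, ξ.map_zero]
  smooth := by
    filter_upwards [f.smooth, f.tendsto.eventually ξ.smooth] with y h₁ h₂
    exact ContMDiffAt.comp y h₂ (contMDiffAt_iff_contDiffAt.2 h₁)
  invertible := by
    rw [mfderiv_comp 0 (I' := 𝓘(ℝ, E)) (by rw [f.map_zero]; exact ξ.mdifferentiableAt)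
      f.differentiableAt.mdifferentiableAt, mfderiv_eq_fderiv]
    refine ContinuousLinearMap.IsInvertible.comp ?_ f.invertible
    rw [f.map_zero]
    exact ξ.invertible

variable [IsManifold 𝓘(ℝ, E) ∞ M]

/-- The expression `y ↦ φ (ξ y) - φ x` of `ξ` in a chart `φ`. -/
def toDiffeoGerm {φ : OpenPartialHomeomorph M E} (hφ : φ ∈ atlas E M) (hx : x ∈ φ.source)
    (ξ : FrameGerm E x) : DiffeoGerm E where
  toFun := fun y => φ (ξ.toFun y) - φ x
  map_zero := by simp [ξ.map_zero]
  smooth := by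
    filter_upwards [ξ.smooth, ξ.tendsto.eventually (φ.open_source.mem_nhds hx)] with y h₁ h₂
    have h3 : ContMDiffAt 𝓘(ℝ, E) 𝓘(ℝ, E) ∞ φ (ξ.toFun y) :=
      contMDiffAt_of_mem_maximalAtlas (IsManifold.subset_maximalAtlas hφ) h₂
    exact (contMDiffAt_iff_contDiffAt.1 (h3.comp y h₁)).sub contDiffAt_const
  invertible := by
    have : IsManifold 𝓘(ℝ, E) 1 M := IsManifold.of_le (n := ∞) (by simp)
    have hd := mdifferentiable_of_mem_atlas (I := 𝓘(ℝ, E)) hφ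
    rw [fderiv_sub_const]
    have h1 : mfderiv 𝓘(ℝ, E) 𝓘(ℝ, E) (φ ∘ ξ.toFun) 0 = fderiv ℝ (fun y => φ (ξ.toFun y)) 0 :=
      mfderiv_eq_fderiv
    rw [← h1, mfderiv_comp 0 (I' := 𝓘(ℝ, E))
      (by rw [ξ.map_zero]; exact hd.mdifferentiableAt hx) ξ.mdifferentiableAt]
    refine ContinuousLinearMap.IsInvertible.comp ?_ ξ.invertible
    rw [ξ.map_zero]
    exact ⟨hd.mfderiv hx, rfl⟩

/-- The parametrization `y ↦ φ⁻¹ (φ x + f y)`. -/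
def ofDiffeoGerm {φ : OpenPartialHomeomorph M E} (hφ : φ ∈ atlas E M) (hx : x ∈ φ.source)
    (f : DiffeoGerm E) : FrameGerm E x where
  toFun := fun y => φ.symm (φ x + f.toFun y)
  map_zero := by simp [f.map_zero, φ.left_inv hx]
  smooth := by
    have ht : Tendsto (fun y => φ x + f.toFun y) (𝓝 0) (𝓝 (φ x)) := by
      simpa using tendsto_const_nhds.add f.tendsto
    filter_upwards [f.smooth, ht.eventually (φ.open_target.mem_nhds (φ.map_source hx))]
      with y h₁ h₂
    have h3 : ContMDiffAt 𝓘(ℝ, E) 𝓘(ℝ, E) ∞ φ.symm (φ x + f.toFun y) :=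
      contMDiffAt_symm_of_mem_maximalAtlas (IsManifold.subset_maximalAtlas hφ) h₂
    exact h3.comp y (contMDiffAt_iff_contDiffAt.2 (contDiffAt_const.add h₁))
  invertible := by
    have : IsManifold 𝓘(ℝ, E) 1 M := IsManifold.of_le (n := ∞) (by simp)
    have hd := (mdifferentiable_of_mem_atlas (I := 𝓘(ℝ, E)) hφ).symm
    have h1 : mfderiv 𝓘(ℝ, E) 𝓘(ℝ, E) (fun y => φ x + f.toFun y) 0 = fderiv ℝ f.toFun 0 := by
      rw [mfderiv_eq_fderiv]
      exact fderiv_const_add _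
    have h0 : φ x + f.toFun 0 = φ x := by simp [f.map_zero]
    have hc : (fun y => φ.symm (φ x + f.toFun y)) = φ.symm ∘ (fun y => φ x + f.toFun y) := rfl
    rw [hc, mfderiv_comp 0 (I' := 𝓘(ℝ, E))
      (by rw [h0]; exact hd.mdifferentiableAt (φ.map_source hx))
      (f.differentiableAt.const_add _).mdifferentiableAt, h1]
    refine ContinuousLinearMap.IsInvertible.comp ?_ f.invertible
    rw [h0]
    exact ⟨hd.mfderiv (φ.map_source hx), rfl⟩

/-- The change of charts `y ↦ ψ (φ⁻¹ (φ x + y)) - ψ x`, centered at `x`. -/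
def transition {φ ψ : OpenPartialHomeomorph M E} (hφ : φ ∈ atlas E M) (hψ : ψ ∈ atlas E M)
    (hx : x ∈ φ.source) (hx' : x ∈ ψ.source) : DiffeoGerm E :=
  toDiffeoGerm hψ hx' (ofDiffeoGerm hφ hx DiffeoGerm.id)

theorem toDiffeoGerm_eventuallyEq {φ ψ : OpenPartialHomeomorph M E} (hφ : φ ∈ atlas E M)
    (hψ : ψ ∈ atlas E M) (hx : x ∈ φ.source) (hx' : x ∈ ψ.source) (ξ : FrameGerm E x) :
    (toDiffeoGerm hψ hx' ξ).toFun =ᶠ[𝓝 0]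
      ((transition hφ hψ hx hx').comp (toDiffeoGerm hφ hx ξ)).toFun := by
  filter_upwards [ξ.tendsto.eventually (φ.open_source.mem_nhds hx)] with y hy
  simp [toDiffeoGerm, transition, ofDiffeoGerm, DiffeoGerm.comp, DiffeoGerm.id, φ.left_inv hy]

theorem sameJet_iff {r : ℕ} (ξ η : FrameGerm E x) :
    SameJet r (chartAt E x ∘ ξ.toFun) (chartAt E x ∘ η.toFun) ↔
      JetGroup.mk r (toDiffeoGerm (chart_mem_atlas E x) (mem_chart_source E x) ξ) =
        JetGroup.mk r (toDiffeoGerm (chart_mem_atlas E x) (mem_chart_source E x) η) := by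
  rw [JetGroup.mk_eq_mk]
  refine ⟨fun h => h.sub_const _, fun h => ?_⟩
  have := h.sub_const (-(chartAt E x x))
  simpa [toDiffeoGerm, Function.comp_def] using this

theorem mk_toDiffeoGerm {r : ℕ} {φ ψ : OpenPartialHomeomorph M E} (hφ : φ ∈ atlas E M)
    (hψ : ψ ∈ atlas E M) (hx : x ∈ φ.source) (hx' : x ∈ ψ.source) (ξ : FrameGerm E x) :
    JetGroup.mk r (toDiffeoGerm hψ hx' ξ) =
      JetGroup.mk r (transition hφ hψ hx hx') * JetGroup.mk r (toDiffeoGerm hφ hx ξ) :=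
  JetGroup.mk_eq_mk.2 (SameJet.of_eventuallyEq (toDiffeoGerm_eventuallyEq hφ hψ hx hx' ξ))

/-- Equality of `r`-jets can be tested in any chart. -/
theorem sameJet_chart {r : ℕ} {φ : OpenPartialHomeomorph M E} (hφ : φ ∈ atlas E M)
    (hx : x ∈ φ.source) (ξ η : FrameGerm E x)
    (h : SameJet r (chartAt E x ∘ ξ.toFun) (chartAt E x ∘ η.toFun)) :
    JetGroup.mk r (toDiffeoGerm hφ hx ξ) = JetGroup.mk r (toDiffeoGerm hφ hx η) := by
  rw [mk_toDiffeoGerm (chart_mem_atlas E x) hφ (mem_chart_source E x) hx ξ,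
    mk_toDiffeoGerm (chart_mem_atlas E x) hφ (mem_chart_source E x) hx η, (sameJet_iff ξ η).1 h]

end FrameGerm

namespace FrameFiber

variable {r : ℕ} {x : M}

/-- The `r`-jet at `0` of `ξ`. -/
def mk (r : ℕ) (ξ : FrameGerm E x) : FrameFiber E r x := Quotient.mk (frameSetoid r x) ξ

variable [IsManifold 𝓘(ℝ, E) ∞ M]

/-- The right action of the jet group on frames: `(j ξ) · (j f) = j (ξ ∘ f)`. -/
def act : FrameFiber E r x → JetGroup r E → FrameFiber E r x :=
  Quotient.map₂ FrameGerm.comp fun ξ ξ' h f f' h' => by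
    refine (FrameGerm.sameJet_iff _ _).2 ?_
    have h := (FrameGerm.sameJet_iff ξ ξ').1 h
    have h' : JetGroup.mk r f = JetGroup.mk r f' := JetGroup.mk_eq_mk.2 h'
    exact congrArg₂ (· * ·) h h'

theorem act_one (u : FrameFiber E r x) : u.act 1 = u := by
  obtain ⟨ξ⟩ := u; rfl

theorem act_mul (u : FrameFiber E r x) (a b : JetGroup r E) :
    u.act (a * b) = (u.act a).act b := by
  obtain ⟨ξ⟩ := u; obtain ⟨f⟩ := a; obtain ⟨g⟩ := b; rfl

/-- The coordinate in the jet group of a frame at `x`, relative to the frame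
`j (y ↦ φ⁻¹ (φ x + y))` given by a chart `φ`. -/
def coord {φ : OpenPartialHomeomorph M E} (hφ : φ ∈ atlas E M) (hx : x ∈ φ.source) :
    FrameFiber E r x → JetGroup r E :=
  Quotient.lift (s := frameSetoid r x)
    (fun ξ => JetGroup.mk r (FrameGerm.toDiffeoGerm hφ hx ξ))
    (fun ξ η h => FrameGerm.sameJet_chart hφ hx ξ η h)

/-- The frame `j (y ↦ φ⁻¹ (φ x + y))` at `x` given by a chart `φ`. -/
def ofChart (r : ℕ) {φ : OpenPartialHomeomorph M E} (hφ : φ ∈ atlas E M) (hx : x ∈ φ.source) :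
    FrameFiber E r x := mk r (FrameGerm.ofDiffeoGerm hφ hx DiffeoGerm.id)

variable {φ ψ : OpenPartialHomeomorph M E} (hφ : φ ∈ atlas E M) (hψ : ψ ∈ atlas E M)
  (hx : x ∈ φ.source) (hx' : x ∈ ψ.source)

theorem coord_act (u : FrameFiber E r x) (a : JetGroup r E) :
    coord hφ hx (u.act a) = coord hφ hx u * a := by
  obtain ⟨ξ⟩ := u; obtain ⟨f⟩ := a; rfl

theorem coord_ofChart : coord hφ hx (ofChart r hφ hx) = 1 := by
  refine JetGroup.mk_eq_mk.2 (SameJet.of_eventuallyEq ?_)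
  have ht : Tendsto (fun y => φ x + y) (𝓝 0) (𝓝 (φ x)) := by
    simpa using (tendsto_const_nhds (x := φ x)).add (tendsto_id (α := E) (x := 𝓝 0))
  filter_upwards [ht.eventually (φ.open_target.mem_nhds (φ.map_source hx))] with y hy
  simp [FrameGerm.toDiffeoGerm, FrameGerm.ofDiffeoGerm, DiffeoGerm.id, φ.right_inv hy]

theorem coord_trans (u : FrameFiber E r x) :
    coord hψ hx' u = JetGroup.mk r (FrameGerm.transition hφ hψ hx hx') * coord hφ hx u := by
  obtain ⟨ξ⟩ := u
  exact FrameGerm.mk_toDiffeoGerm hφ hψ hx hx' ξ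

theorem coord_injective :
    Function.Injective (coord hφ hx : FrameFiber E r x → JetGroup r E) := by
  intro u v h
  have h1 := coord_trans (r := r) hφ (chart_mem_atlas E x) hx (mem_chart_source E x)
  have h2 : coord (chart_mem_atlas E x) (mem_chart_source E x) u =
      coord (chart_mem_atlas E x) (mem_chart_source E x) v := by rw [h1, h1 v, h]
  obtain ⟨ξ⟩ := u; obtain ⟨η⟩ := v
  exact Quotient.sound (s := frameSetoid r x) ((FrameGerm.sameJet_iff ξ η).2 h2)

/-- The jet group acts simply transitively on the frames at `x`. -/
theorem ofChart_act_coord (u : FrameFiber E r x) : (ofChart r hφ hx).act (coord hφ hx u) = u :=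
  coord_injective hφ hx (by rw [coord_act, coord_ofChart, one_mul])

end FrameFiber

end Frames

section Associated

variable {E : Type*} [NormedAddCommGroup E] [NormedSpace ℝ E] [FiniteDimensional ℝ E]
  {F : Type*} [NormedAddCommGroup F] [NormedSpace ℝ F] [CompleteSpace F]
  {M : Type*} [TopologicalSpace M] [ChartedSpace E M] [IsManifold 𝓘(ℝ, E) ∞ M] {r : ℕ}

/-- The linear representations of the Lie group `Gʳ(E)` on `F`: the smooth homomorphisms
from `Gʳ(E)` to the general linear group `GL(F)`. -/
abbrev JetRep (r : ℕ) (E : Type*) [NormedAddCommGroup E] [NormedSpace ℝ E] [FiniteDimensional ℝ E]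
    (F : Type*) [NormedAddCommGroup F] [NormedSpace ℝ F] [CompleteSpace F] : Type _ :=
  ContMDiffMonoidMorphism 𝓘(ℝ, JetSpace r E) 𝓘(ℝ, F →L[ℝ] F) ∞ (JetGroup r E) (F →L[ℝ] F)ˣ

/-- The action of a jet on `F` through the representation `ρ`. -/
def JetRep.op (ρ : JetRep r E F) (a : JetGroup r E) : F →L[ℝ] F := (ρ.toMonoidHom a : F →L[ℝ] F)

theorem JetRep.op_one (ρ : JetRep r E F) (v : F) : ρ.op 1 v = v := by simp [JetRep.op]

theorem JetRep.op_mul (ρ : JetRep r E F) (a b : JetGroup r E) (v : F) :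
    ρ.op (a * b) v = ρ.op a (ρ.op b v) := by simp [JetRep.op]

theorem JetRep.op_inv (ρ : JetRep r E F) (a : JetGroup r E) (v : F) :
    ρ.op a (ρ.op a⁻¹ v) = v := by rw [← ρ.op_mul, mul_inv_cancel, ρ.op_one]

/-- The equivalence relation `(u · a, v) ∼ (u, ρ(a) v)` on `Fʳ(M)_x × F`. -/
@[reducible] def assocSetoid (ρ : JetRep r E F) (x : M) : Setoid (FrameFiber E r x × F) where
  r p q := ∃ a : JetGroup r E, q.1 = p.1.act a ∧ p.2 = ρ.op a q.2
  iseqv := by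
    refine ⟨fun p => ⟨1, by rw [FrameFiber.act_one], by rw [ρ.op_one]⟩, ?_, ?_⟩
    · rintro ⟨u, v⟩ ⟨u', v'⟩ ⟨a, h₁, h₂⟩
      dsimp only at h₁ h₂
      refine ⟨a⁻¹, ?_, ?_⟩
      · rw [h₁, ← FrameFiber.act_mul, mul_inv_cancel, FrameFiber.act_one]
      · rw [h₂, ← ρ.op_mul, inv_mul_cancel, ρ.op_one]
    · rintro ⟨u, v⟩ ⟨u', v'⟩ ⟨u'', v''⟩ ⟨a, h₁, h₂⟩ ⟨b, h₃, h₄⟩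
      dsimp only at h₁ h₂ h₃ h₄
      exact ⟨a * b, by rw [h₃, h₁, FrameFiber.act_mul], by rw [h₂, h₄, ρ.op_mul]⟩

/-- The fibre at `x` of the bundle `Fʳ(M) ×_{Gʳ(E)} F` associated with the frame bundle `Fʳ(M)`
through the representation `ρ`. The total space, the quotient of `Fʳ(M) × F` by the jet group, is
`Bundle.TotalSpace F (AssocFiber ρ)`; its smooth structure is the one for which the local
trivializations defined by the local sections `x ↦ j (y ↦ φ⁻¹ (φ x + y))` of `Fʳ(M)`, `φ` a chart
of `M`, are smooth (see `assocPrebundle`). -/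
def AssocFiber (ρ : JetRep r E F) (x : M) : Type _ := Quotient (assocSetoid ρ x)

namespace AssocFiber

variable {ρ : JetRep r E F} {x : M}

/-- The class `[u, v]`. -/
def mk (ρ : JetRep r E F) (u : FrameFiber E r x) (v : F) : AssocFiber ρ x :=
  Quotient.mk (assocSetoid ρ x) (u, v)

theorem mk_act (u : FrameFiber E r x) (a : JetGroup r E) (v : F) :
    mk ρ (u.act a) v = mk ρ u (ρ.op a v) :=
  (Quotient.sound (s := assocSetoid ρ x) ⟨a, rfl, rfl⟩).symm

section

variable {φ ψ : OpenPartialHomeomorph M E} (hφ : φ ∈ atlas E M) (hψ : ψ ∈ atlas E M)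
  (hx : x ∈ φ.source) (hx' : x ∈ ψ.source)

/-- The bijection between the fibre at `x` and `F` given by the frame of a chart `φ`: the
vector `v` corresponds to `[u, v]`, where `u = j (y ↦ φ⁻¹ (φ x + y))`. -/
def equiv : AssocFiber ρ x ≃ F where
  toFun := Quotient.lift (s := assocSetoid ρ x)
    (fun p => ρ.op (FrameFiber.coord hφ hx p.1) p.2) (by
      rintro ⟨u, v⟩ ⟨u', v'⟩ ⟨a, h₁, h₂⟩
      dsimp only at h₁ h₂ ⊢
      rw [h₁, h₂, FrameFiber.coord_act, ρ.op_mul])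
  invFun v := mk ρ (FrameFiber.ofChart r hφ hx) v
  left_inv := by
    rintro ⟨u, v⟩
    change mk ρ _ (ρ.op (FrameFiber.coord hφ hx u) v) = mk ρ u v
    rw [← mk_act, FrameFiber.ofChart_act_coord]
  right_inv v := by
    change ρ.op (FrameFiber.coord hφ hx (FrameFiber.ofChart r hφ hx)) v = v
    rw [FrameFiber.coord_ofChart, ρ.op_one]

theorem equiv_mk (u : FrameFiber E r x) (v : F) :
    equiv hφ hx (mk ρ u v) = ρ.op (FrameFiber.coord hφ hx u) v := rfl

theorem equiv_trans (p : AssocFiber ρ x) :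
    equiv hψ hx' p =
      ρ.op (JetGroup.mk r (FrameGerm.transition hφ hψ hx hx')) (equiv hφ hx p) := by
  obtain ⟨u, v⟩ := p
  change ρ.op (FrameFiber.coord hψ hx' u) v = ρ.op _ (ρ.op (FrameFiber.coord hφ hx u) v)
  rw [← ρ.op_mul, ← FrameFiber.coord_trans]

end

/-- The vector space structure on the fibres, `[u, v] + [u, w] = [u, v + w]` and
`c • [u, v] = [u, c • v]` (see `mk_add`, `mk_smul`). -/
instance : AddCommGroup (AssocFiber ρ x) :=
  (equiv (ρ := ρ) (chart_mem_atlas E x) (mem_chart_source E x)).addCommGroup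

instance : Module ℝ (AssocFiber ρ x) :=
  (equiv (ρ := ρ) (chart_mem_atlas E x) (mem_chart_source E x)).module ℝ

instance : TopologicalSpace (AssocFiber ρ x) :=
  .induced (equiv (ρ := ρ) (chart_mem_atlas E x) (mem_chart_source E x)) inferInstance

/-- `AssocFiber.equiv` for the preferred chart at `x`, as a linear equivalence. -/
def linearEquiv (ρ : JetRep r E F) (x : M) : AssocFiber ρ x ≃ₗ[ℝ] F :=
  (equiv (ρ := ρ) (chart_mem_atlas E x) (mem_chart_source E x)).linearEquiv ℝ

theorem linearEquiv_mk (u : FrameFiber E r x) (v : F) :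
    linearEquiv ρ x (mk ρ u v) =
      ρ.op (FrameFiber.coord (chart_mem_atlas E x) (mem_chart_source E x) u) v := rfl

theorem mk_add (u : FrameFiber E r x) (v w : F) : mk ρ u v + mk ρ u w = mk ρ u (v + w) :=
  (linearEquiv ρ x).injective (by simp only [map_add, linearEquiv_mk])

theorem mk_smul (c : ℝ) (u : FrameFiber E r x) (v : F) : c • mk ρ u v = mk ρ u (c • v) :=
  (linearEquiv ρ x).injective (by simp only [map_smul, linearEquiv_mk])

theorem equiv_eq {φ : OpenPartialHomeomorph M E} (hφ : φ ∈ atlas E M) (hx : x ∈ φ.source)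
    (p : AssocFiber ρ x) : equiv hφ hx p = ρ.op (JetGroup.mk r (FrameGerm.transition
      (chart_mem_atlas E x) hφ (mem_chart_source E x) hx)) (linearEquiv ρ x p) :=
  equiv_trans _ _ _ _ p

end AssocFiber

open Classical in
/-- The local trivialization of the associated bundle given by a chart `φ`. Over `x` in the domain
of `φ` it maps `[u, v]` to `v`, where `u = j (y ↦ φ⁻¹ (φ x + y))`. -/
def assocTriv (ρ : JetRep r E F) {φ : OpenPartialHomeomorph M E} (hφ : φ ∈ atlas E M) :
    Pretrivialization F (π F (AssocFiber ρ : M → Type _)) where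
  toFun p := (p.1, if h : p.1 ∈ φ.source then AssocFiber.equiv hφ h p.2 else 0)
  invFun q := ⟨q.1, if h : q.1 ∈ φ.source then (AssocFiber.equiv hφ h).symm q.2 else 0⟩
  source := π F (AssocFiber ρ : M → Type _) ⁻¹' φ.source
  target := φ.source ×ˢ univ
  map_source' p hp := ⟨hp, mem_univ _⟩
  map_target' q hq := hq.1
  left_inv' := by
    rintro ⟨x, p⟩ hx
    have hx : x ∈ φ.source := hx
    simp [hx]
  right_inv' := by
    rintro ⟨x, v⟩ ⟨hx, -⟩
    have hx : x ∈ φ.source := hx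
    simp [hx]
  open_target := φ.open_source.prod isOpen_univ
  baseSet := φ.source
  open_baseSet := φ.open_source
  source_eq := rfl
  target_eq := rfl
  proj_toFun p hp := rfl

theorem assocTriv_apply (ρ : JetRep r E F) {φ : OpenPartialHomeomorph M E} (hφ : φ ∈ atlas E M)
    {x : M} (hx : x ∈ φ.source) (p : AssocFiber ρ x) :
    assocTriv ρ hφ ⟨x, p⟩ = (x, AssocFiber.equiv hφ hx p) :=
  Prod.ext rfl (dif_pos hx)

theorem assocTriv_symm (ρ : JetRep r E F) {φ : OpenPartialHomeomorph M E} (hφ : φ ∈ atlas E M)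
    {x : M} (hx : x ∈ φ.source) (v : F) :
    (assocTriv ρ hφ).symm x v = (AssocFiber.equiv hφ hx).symm v := by
  refine (AssocFiber.equiv hφ hx).injective ?_
  have h := (assocTriv ρ hφ).apply_mk_symm (b := x) hx v
  rw [assocTriv_apply ρ hφ hx] at h
  rw [Equiv.apply_symm_apply]
  exact congrArg Prod.snd h

open Classical in
/-- The jet of the change of charts at `x`. -/
def transitionJet (r : ℕ) {φ ψ : OpenPartialHomeomorph M E} (hφ : φ ∈ atlas E M)
    (hψ : ψ ∈ atlas E M) (x : M) : JetGroup r E :=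
  if h : x ∈ φ.source ∧ x ∈ ψ.source then
    JetGroup.mk r (FrameGerm.transition hφ hψ h.1 h.2) else 1

theorem assocTriv_coordChange (ρ : JetRep r E F) {φ ψ : OpenPartialHomeomorph M E}
    (hφ : φ ∈ atlas E M) (hψ : ψ ∈ atlas E M) {x : M}
    (hx : x ∈ φ.source ∩ ψ.source) (v : F) :
    ρ.op (transitionJet r hφ hψ x) v =
      (assocTriv ρ hψ ⟨x, (assocTriv ρ hφ).symm x v⟩).2 := by
  rw [assocTriv_symm ρ hφ hx.1, assocTriv_apply ρ hψ hx.2,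
    AssocFiber.equiv_trans hφ hψ hx.1 hx.2, Equiv.apply_symm_apply]
  simp only [transitionJet]
  rw [dif_pos ⟨hx.1, hx.2⟩]

theorem exists_contDiff_leftInverse {W : Type*} [NormedAddCommGroup W] [NormedSpace ℝ W]
    [FiniteDimensional ℝ W] (S : Submodule ℝ W) :
    ∃ p : W → S, ContDiff ℝ ∞ p ∧ ∀ x : S, p x = x := by
  obtain ⟨p, hp⟩ := LinearMap.exists_leftInverse_of_injective S.subtype (Submodule.ker_subtype _)
  exact ⟨p, p.toContinuousLinearMap.contDiff, fun x => LinearMap.congr_fun hp x⟩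

theorem JetGroup.contMDiffOn_of_coords {f : M → JetGroup r E} {s : Set M}
    (h : ∀ k : Fin r, ContMDiffOn 𝓘(ℝ, E) 𝓘(ℝ, E [×((k : ℕ) + 1)]→L[ℝ] E) ∞
      (fun x => (JetGroup.coords (f x)).1 k) s) :
    ContMDiffOn 𝓘(ℝ, E) 𝓘(ℝ, JetSpace r E) ∞ f s := by
  have hfin : ∀ k : ℕ, FiniteDimensional ℝ (E [×k]→L[ℝ] E) := fun k =>
    Module.Finite.of_injective
      (ContinuousMultilinearMap.toMultilinearMapLinear :
        (E [×k]→L[ℝ] E) →ₗ[ℝ] MultilinearMap ℝ (fun _ : Fin k => E) E)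
      ContinuousMultilinearMap.toMultilinearMap_injective
  have hfd := fun k : Fin r => hfin ((k : ℕ) + 1)
  obtain ⟨p, hpc, hp⟩ := exists_contDiff_leftInverse (JetSpace r E)
  have hc : ContMDiffOn 𝓘(ℝ, E) 𝓘(ℝ, JetSpace r E) ∞ (fun x => JetGroup.coords (f x)) s := by
    have h1 : ContMDiffOn 𝓘(ℝ, E) 𝓘(ℝ, ∀ k : Fin r, E [×((k : ℕ) + 1)]→L[ℝ] E) ∞
        (fun x => (JetGroup.coords (f x)).1) s := contMDiffOn_pi_space.2 h
    refine (hpc.contMDiff.comp_contMDiffOn h1).congr fun x _ => ?_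
    exact (hp (JetGroup.coords (f x))).symm
  have h3 := contMDiffOn_isOpenEmbedding_symm (I := 𝓘(ℝ, JetSpace r E)) (n := ∞)
    (JetGroup.isOpenEmbedding_coords (r := r) (E := E))
  have h4 := h3.comp hc (fun x _ => mem_range_self _)
  refine h4.congr fun x _ => ?_
  exact ((JetGroup.isOpenEmbedding_coords (r := r) (E := E)).toOpenPartialHomeomorph_left_inv).symm

theorem contMDiffOn_transitionJet {φ ψ : OpenPartialHomeomorph M E} (hφ : φ ∈ atlas E M)
    (hψ : ψ ∈ atlas E M) :
    ContMDiffOn 𝓘(ℝ, E) 𝓘(ℝ, JetSpace r E) ∞ (transitionJet r hφ hψ)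
      (φ.source ∩ ψ.source) := by
  refine JetGroup.contMDiffOn_of_coords fun k => ?_
  have hmφ : φ ∈ IsManifold.maximalAtlas 𝓘(ℝ, E) ∞ M := IsManifold.subset_maximalAtlas hφ
  have hmψ : ψ ∈ IsManifold.maximalAtlas 𝓘(ℝ, E) ∞ M := IsManifold.subset_maximalAtlas hψ
  have h1 : ∀ x ∈ φ.source ∩ ψ.source, ContDiffAt ℝ ∞ (ψ ∘ φ.symm) (φ x) := by
    rintro x ⟨hx, hx'⟩
    refine contMDiffAt_iff_contDiffAt.1 (ContMDiffAt.comp (I' := 𝓘(ℝ, E)) _ ?_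
      (contMDiffAt_symm_of_mem_maximalAtlas hmφ (φ.map_source hx)))
    rw [φ.left_inv hx]
    exact contMDiffAt_of_mem_maximalAtlas hmψ hx'
  have h2 : ContMDiffOn 𝓘(ℝ, E) 𝓘(ℝ, E [×((k : ℕ) + 1)]→L[ℝ] E) ∞
      (fun x => iteratedFDeriv ℝ ((k : ℕ) + 1) (ψ ∘ φ.symm) (φ x)) (φ.source ∩ ψ.source) := by
    intro x hx
    have h3 : ContDiffAt ℝ ∞ (iteratedFDeriv ℝ ((k : ℕ) + 1) (ψ ∘ φ.symm)) (φ x) :=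
      (h1 x hx).iteratedFDeriv_right (by exact_mod_cast le_top)
    exact ((contMDiffAt_iff_contDiffAt.2 h3).comp x
      (contMDiffAt_of_mem_maximalAtlas hmφ hx.1)).contMDiffWithinAt
  refine h2.congr fun x hx => ?_
  rw [transitionJet, dif_pos ⟨hx.1, hx.2⟩, JetGroup.coords_mk]
  change iteratedFDeriv ℝ ((k : ℕ) + 1) (fun y => (ψ ∘ φ.symm) (φ x + y) - ψ x) 0 = _
  rw [iteratedFDeriv_sub_const_succ, iteratedFDeriv_comp_add_left, add_zero]

theorem contMDiffOn_op_transitionJet (ρ : JetRep r E F) {φ ψ : OpenPartialHomeomorph M E}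
    (hφ : φ ∈ atlas E M) (hψ : ψ ∈ atlas E M) :
    ContMDiffOn 𝓘(ℝ, E) 𝓘(ℝ, F →L[ℝ] F) ∞ (fun x => ρ.op (transitionJet r hφ hψ x))
      (φ.source ∩ ψ.source) :=
  (Units.contMDiff_val.comp ρ.contMDiff_toFun).comp_contMDiffOn (contMDiffOn_transitionJet hφ hψ)

/-- The local trivializations of the associated bundle given by the charts of `M`. -/
def assocPrebundle (ρ : JetRep r E F) :
    VectorPrebundle ℝ F (AssocFiber ρ : M → Type _) where
  pretrivializationAtlas := {e | ∃ (φ : OpenPartialHomeomorph M E) (hφ : φ ∈ atlas E M),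
    e = assocTriv ρ hφ}
  pretrivialization_linear' := by
    rintro _ ⟨φ, hφ, rfl⟩
    refine ⟨fun x hx => ?_⟩
    have hx : x ∈ φ.source := hx
    have h : ∀ p : AssocFiber ρ x, (assocTriv ρ hφ ⟨x, p⟩).2 = ρ.op (JetGroup.mk r
        (FrameGerm.transition (chart_mem_atlas E x) hφ (mem_chart_source E x) hx))
          (AssocFiber.linearEquiv ρ x p) := fun p => by
      rw [assocTriv_apply ρ hφ hx, AssocFiber.equiv_eq]
    exact ⟨fun p q => by simp only [h, map_add], fun c p => by simp only [h, map_smul]⟩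
  pretrivializationAt x := assocTriv ρ (chart_mem_atlas E x)
  mem_base_pretrivializationAt x := mem_chart_source E x
  pretrivialization_mem_atlas x := ⟨_, _, rfl⟩
  exists_coordChange := by
    rintro _ ⟨φ, hφ, rfl⟩ _ ⟨ψ, hψ, rfl⟩
    exact ⟨fun x => ρ.op (transitionJet r hφ hψ x),
      (contMDiffOn_op_transitionJet ρ hφ hψ).continuousOn,
      fun x hx v => assocTriv_coordChange ρ hφ hψ hx v⟩
  totalSpaceMk_isInducing x := by
    have h : (assocTriv ρ (chart_mem_atlas E x)) ∘ TotalSpace.mk x =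
        Prod.mk x ∘ AssocFiber.equiv (ρ := ρ) (chart_mem_atlas E x) (mem_chart_source E x) :=
      funext fun p => assocTriv_apply ρ (chart_mem_atlas E x) (mem_chart_source E x) p
    rw [h]
    exact (Topology.isInducing_const_prod.2 Topology.IsInducing.id).comp ⟨rfl⟩

instance (ρ : JetRep r E F) : (assocPrebundle (M := M) ρ).IsContMDiff 𝓘(ℝ, E) ∞ where
  exists_contMDiffCoordChange := by
    rintro _ ⟨φ, hφ, rfl⟩ _ ⟨ψ, hψ, rfl⟩
    exact ⟨fun x => ρ.op (transitionJet r hφ hψ x), contMDiffOn_op_transitionJet ρ hφ hψ,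
      fun x hx v => assocTriv_coordChange ρ hφ hψ hx v⟩

instance (ρ : JetRep r E F) : TopologicalSpace (TotalSpace F (AssocFiber ρ : M → Type _)) :=
  (assocPrebundle ρ).totalSpaceTopology

instance (ρ : JetRep r E F) : FiberBundle F (AssocFiber ρ : M → Type _) :=
  (assocPrebundle ρ).toFiberBundle

instance (ρ : JetRep r E F) : VectorBundle ℝ F (AssocFiber ρ : M → Type _) :=
  (assocPrebundle ρ).toVectorBundle

/-- The associated bundle is a smooth vector bundle over `M`. -/
instance (ρ : JetRep r E F) :
    ContMDiffVectorBundle ∞ F (AssocFiber ρ : M → Type _) 𝓘(ℝ, E) :=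
  (assocPrebundle ρ).contMDiffVectorBundle 𝓘(ℝ, E)

end Associated

section Automorphisms

variable {E : Type*} [NormedAddCommGroup E] [NormedSpace ℝ E]
  {F : Type*} [NormedAddCommGroup F] [NormedSpace ℝ F]
  {M : Type*} [TopologicalSpace M] [ChartedSpace E M]

/-- The group `Diff M`. -/
instance : Group (Diffeomorph 𝓘(ℝ, E) 𝓘(ℝ, E) M M ∞) where
  mul φ ψ := ψ.trans φ
  one := Diffeomorph.refl 𝓘(ℝ, E) M ∞
  inv φ := φ.symm
  mul_assoc _ _ _ := Diffeomorph.ext fun _ => rfl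
  one_mul _ := Diffeomorph.ext fun _ => rfl
  mul_one _ := Diffeomorph.ext fun _ => rfl
  inv_mul_cancel φ := Diffeomorph.ext fun x => φ.symm_apply_apply x

variable (F) (V : M → Type*) [TopologicalSpace (TotalSpace F V)] [∀ x, AddCommGroup (V x)]
  [∀ x, Module ℝ (V x)] [∀ x, TopologicalSpace (V x)] [FiberBundle F V]

variable (E) in
/-- An automorphism of the vector bundle `V`: a diffeomorphism of the total space mapping every
fibre `V x` linearly onto a fibre `V x'`. -/
structure BundleAut where
  toDiffeomorph :
    Diffeomorph (𝓘(ℝ, E).prod 𝓘(ℝ, F)) (𝓘(ℝ, E).prod 𝓘(ℝ, F)) (TotalSpace F V) (TotalSpace F V) ∞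
  linear : ∀ x : M, ∃ (x' : M) (A : V x ≃ₗ[ℝ] V x'), ∀ v : V x, toDiffeomorph ⟨x, v⟩ = ⟨x', A v⟩

namespace BundleAut

variable {F V}

theorem toDiffeomorph_injective : Function.Injective (toDiffeomorph : BundleAut E F V → _) := by
  rintro ⟨Φ, _⟩ ⟨Ψ, _⟩ h
  cases h
  rfl

/-- The group `AUT V`, under composition. -/
instance : Group (BundleAut E F V) where
  mul Φ Ψ := ⟨Ψ.toDiffeomorph.trans Φ.toDiffeomorph, fun x => by
    obtain ⟨y, A, hA⟩ := Ψ.linear x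
    obtain ⟨z, B, hB⟩ := Φ.linear y
    exact ⟨z, A.trans B, fun v => by simp [hA, hB]⟩⟩
  one := ⟨Diffeomorph.refl _ _ _, fun x => ⟨x, LinearEquiv.refl ℝ _, fun v => rfl⟩⟩
  inv Φ := ⟨Φ.toDiffeomorph.symm, fun y => by
    obtain ⟨x, hx⟩ : ∃ x : M, x = (Φ.toDiffeomorph.symm ⟨y, 0⟩).1 := ⟨_, rfl⟩
    obtain ⟨z, A, hA⟩ := Φ.linear x
    have h := hA (hx ▸ (Φ.toDiffeomorph.symm ⟨y, 0⟩).2)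
    have h' : (⟨x, hx ▸ (Φ.toDiffeomorph.symm ⟨y, 0⟩).2⟩ : TotalSpace F V) =
        Φ.toDiffeomorph.symm ⟨y, 0⟩ := by subst hx; rfl
    rw [h', Φ.toDiffeomorph.apply_symm_apply] at h
    have hz : y = z := congrArg TotalSpace.proj h
    subst hz
    exact ⟨x, A.symm, fun v => Φ.toDiffeomorph.injective <| by
      change Φ.toDiffeomorph (Φ.toDiffeomorph.symm _) = Φ.toDiffeomorph _
      rw [Φ.toDiffeomorph.apply_symm_apply, hA, A.apply_symm_apply]⟩⟩
  mul_assoc _ _ _ := toDiffeomorph_injective (Diffeomorph.ext fun _ => rfl)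
  one_mul _ := toDiffeomorph_injective (Diffeomorph.ext fun _ => rfl)
  mul_one _ := toDiffeomorph_injective (Diffeomorph.ext fun _ => rfl)
  inv_mul_cancel Φ := toDiffeomorph_injective
    (Diffeomorph.ext fun x => Φ.toDiffeomorph.symm_apply_apply x)

/-- The map `φ` of `M` induced by an automorphism `Φ`, `Φ (V x) = V (φ x)`. -/
def baseMap (Φ : BundleAut E F V) (x : M) : M := (Φ.toDiffeomorph ⟨x, 0⟩).1

theorem proj_apply (Φ : BundleAut E F V) (p : TotalSpace F V) :
    (Φ.toDiffeomorph p).1 = Φ.baseMap p.1 := by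
  obtain ⟨x, v⟩ := p
  obtain ⟨y, A, hA⟩ := Φ.linear x
  simp [baseMap, hA]

theorem baseMap_mul (Φ Ψ : BundleAut E F V) (x : M) :
    (Φ * Ψ).baseMap x = Φ.baseMap (Ψ.baseMap x) :=
  Φ.proj_apply (Ψ.toDiffeomorph ⟨x, 0⟩)

theorem baseMap_one (x : M) : (1 : BundleAut E F V).baseMap x = x := rfl

variable [VectorBundle ℝ F V]

theorem contMDiff_baseMap (Φ : BundleAut E F V) : ContMDiff 𝓘(ℝ, E) 𝓘(ℝ, E) ∞ Φ.baseMap :=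
  (contMDiff_proj V).comp (Φ.toDiffeomorph.contMDiff.comp (contMDiff_zeroSection ℝ V))

/-- The diffeomorphism `φ` of `M` induced by an automorphism `Φ`. -/
def baseDiffeomorph (Φ : BundleAut E F V) : Diffeomorph 𝓘(ℝ, E) 𝓘(ℝ, E) M M ∞ where
  toFun := Φ.baseMap
  invFun := (Φ⁻¹).baseMap
  left_inv x := by rw [← baseMap_mul, inv_mul_cancel, baseMap_one]
  right_inv x := by rw [← baseMap_mul, mul_inv_cancel, baseMap_one]
  contMDiff_toFun := Φ.contMDiff_baseMap
  contMDiff_invFun := (Φ⁻¹).contMDiff_baseMap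

variable (E F V) in
/-- The homomorphism `h_V : AUT V → Diff M`. -/
def baseHom : BundleAut E F V →* Diffeomorph 𝓘(ℝ, E) 𝓘(ℝ, E) M M ∞ where
  toFun := baseDiffeomorph
  map_one' := rfl
  map_mul' Φ Ψ := Diffeomorph.ext (baseMap_mul Φ Ψ)

end BundleAut

end Automorphisms

end JetBundle

end

/-!
The frame bundle is a natural bundle, so diffeomorphisms lift to it and to everything associated
with it. A diffeomorphism `f` of `M` sends the `r`-frame `j ξ` at `x` to the `r`-frame `j (f ∘ ξ)`
at `f x`. This map acts by composition on the left, the jet group by composition on the right, so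
the two commute and `[u, v] ↦ [f_* u, v]` is a well defined map `f_*` of the associated bundle
covering `f`.

Over charts `φ` at `x` and `ψ` at `f x`, the map `f_*` is `v ↦ ρ(a(x)) v`, where `a(x)` is the
`r`-jet at `0` of the local expression `y ↦ ψ (f (φ⁻¹ (φ x + y))) - ψ (f x)` of `f`
(`AssocFiber.equiv_map`). Since `ρ(a(x))` is linear and invertible, `f_*` is a linear isomorphism
on fibres; since the derivatives of `ψ ∘ f ∘ φ⁻¹` depend smoothly on the point, `a` is smooth
(`contMDiffOn_localJet`), and with it `f_*` (`contMDiff_assocMap`). By functoriality the inverse of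
`f_*` is `(f⁻¹)_*`, which is smooth for the same reason; so `f_*` is an automorphism that induces
`f`.
-/

open scoped Manifold ContDiff Topology
open Set Filter Bundle

noncomputable section

namespace JetBundle

/-! ### The action of diffeomorphisms on frames -/

section Frames

variable {E : Type*} [NormedAddCommGroup E] [NormedSpace ℝ E]
  {M : Type*} [TopologicalSpace M] [ChartedSpace E M] {x : M}

/-- The composition `f ∘ ξ`, a frame at `f x`. -/
def FrameGerm.map (f : Diffeomorph 𝓘(ℝ, E) 𝓘(ℝ, E) M M ∞) (ξ : FrameGerm E x) :
    FrameGerm E (f x) where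
  toFun := f ∘ ξ.toFun
  map_zero := by simp [ξ.map_zero]
  smooth := by
    filter_upwards [ξ.smooth] with y hy
    exact f.contMDiff.contMDiffAt.comp y hy
  invertible := by
    rw [mfderiv_comp 0 (I' := 𝓘(ℝ, E)) (f.contMDiff.mdifferentiable (by simp) _)
      ξ.mdifferentiableAt]
    refine ContinuousLinearMap.IsInvertible.comp ?_ ξ.invertible
    exact ⟨(f.isLocalDiffeomorph _).mfderivToContinuousLinearEquiv (by simp),
      IsLocalDiffeomorphAt.mfderivToContinuousLinearEquiv_coe _ _⟩

variable [IsManifold 𝓘(ℝ, E) ∞ M] {r : ℕ}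
  {φ ψ : OpenPartialHomeomorph M E} (hφ : φ ∈ atlas E M) (hψ : ψ ∈ atlas E M)
  (f : Diffeomorph 𝓘(ℝ, E) 𝓘(ℝ, E) M M ∞) (hx : x ∈ φ.source) (hx' : f x ∈ ψ.source)

/-- The local expression `y ↦ ψ (f (φ⁻¹ (φ x + y))) - ψ (f x)` of `f` in the charts `φ` and `ψ`,
centered at `x` and `f x`. -/
def FrameGerm.localExpr : DiffeoGerm E :=
  toDiffeoGerm hψ hx' ((ofDiffeoGerm hφ hx DiffeoGerm.id).map f)

theorem FrameGerm.mk_toDiffeoGerm_map (ξ : FrameGerm E x) :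
    JetGroup.mk r (toDiffeoGerm hψ hx' (ξ.map f)) =
      JetGroup.mk r (localExpr hφ hψ f hx hx') * JetGroup.mk r (toDiffeoGerm hφ hx ξ) := by
  refine JetGroup.mk_eq_mk.2 (SameJet.of_eventuallyEq ?_)
  filter_upwards [ξ.tendsto.eventually (φ.open_source.mem_nhds hx)] with y hy
  simp [toDiffeoGerm, localExpr, ofDiffeoGerm, map, DiffeoGerm.comp, DiffeoGerm.id, φ.left_inv hy]

/-- The map `f_* : Fʳ(M)_x → Fʳ(M)_(f x)`, `j ξ ↦ j (f ∘ ξ)`, of frames. -/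
def FrameFiber.map : FrameFiber E r x → FrameFiber E r (f x) :=
  Quotient.map (FrameGerm.map f) fun ξ η h => by
    refine (FrameGerm.sameJet_iff _ _).2 ?_
    have h := (FrameGerm.sameJet_iff ξ η).1 h
    rw [FrameGerm.mk_toDiffeoGerm_map (chart_mem_atlas E x) _ f (mem_chart_source E x),
      FrameGerm.mk_toDiffeoGerm_map (chart_mem_atlas E x) _ f (mem_chart_source E x), h]

theorem FrameFiber.map_act (u : FrameFiber E r x) (a : JetGroup r E) :
    (u.act a).map f = (u.map f).act a := by
  obtain ⟨ξ⟩ := u; obtain ⟨g⟩ := a; rfl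

theorem FrameFiber.coord_map (u : FrameFiber E r x) :
    coord hψ hx' (u.map f) =
      JetGroup.mk r (FrameGerm.localExpr hφ hψ f hx hx') * coord hφ hx u := by
  obtain ⟨ξ⟩ := u
  exact FrameGerm.mk_toDiffeoGerm_map hφ hψ f hx hx' ξ

end Frames

/-! ### The induced map of the associated bundle -/

section Associated

variable {E : Type*} [NormedAddCommGroup E] [NormedSpace ℝ E] [FiniteDimensional ℝ E]
  {F : Type*} [NormedAddCommGroup F] [NormedSpace ℝ F] [CompleteSpace F]
  {M : Type*} [TopologicalSpace M] [ChartedSpace E M] [IsManifold 𝓘(ℝ, E) ∞ M] {r : ℕ}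
  {ρ : JetRep r E F} {x : M}
  {φ ψ : OpenPartialHomeomorph M E} (hφ : φ ∈ atlas E M) (hψ : ψ ∈ atlas E M)
  (f : Diffeomorph 𝓘(ℝ, E) 𝓘(ℝ, E) M M ∞)

/-- The map `[u, v] ↦ [f_* u, v]` from the fibre at `x` to the fibre at `f x`. -/
def AssocFiber.map : AssocFiber ρ x → AssocFiber ρ (f x) :=
  Quotient.map (fun p => (p.1.map f, p.2)) (by
    rintro ⟨u, v⟩ ⟨u', v'⟩ ⟨a, h₁, h₂⟩
    exact ⟨a, (congrArg (FrameFiber.map f) h₁).trans (FrameFiber.map_act f u a), h₂⟩)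

/-- In the frames given by charts, the induced map is the action of the jet of the local
expression. -/
theorem AssocFiber.equiv_map (hx : x ∈ φ.source) (hx' : f x ∈ ψ.source) (p : AssocFiber ρ x) :
    equiv hψ hx' (p.map f) =
      ρ.op (JetGroup.mk r (FrameGerm.localExpr hφ hψ f hx hx')) (equiv hφ hx p) := by
  obtain ⟨u, v⟩ := p
  change ρ.op (FrameFiber.coord hψ hx' (u.map f)) v = ρ.op _ (ρ.op (FrameFiber.coord hφ hx u) v)
  rw [← ρ.op_mul, ← FrameFiber.coord_map]

theorem AssocFiber.exists_linearEquiv_eq_map :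
    ∃ A : AssocFiber ρ x ≃ₗ[ℝ] AssocFiber ρ (f x), ∀ p, A p = p.map f := by
  let a := JetGroup.mk r (FrameGerm.localExpr (chart_mem_atlas E x) (chart_mem_atlas E (f x)) f
    (mem_chart_source E x) (mem_chart_source E (f x)))
  let e : F ≃ₗ[ℝ] F := LinearEquiv.ofLinearMap (ρ.op a : F →ₗ[ℝ] F) (ρ.op a⁻¹ : F →ₗ[ℝ] F)
    (LinearMap.ext fun v => ρ.op_inv a v)
    (LinearMap.ext fun v => by simpa using ρ.op_inv a⁻¹ v)
  refine ⟨(linearEquiv ρ x).trans (e.trans (linearEquiv ρ (f x)).symm), fun p => ?_⟩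
  refine (linearEquiv ρ (f x)).symm_apply_eq.2 ?_
  exact (equiv_map (chart_mem_atlas E x) (chart_mem_atlas E (f x)) f
    (mem_chart_source E x) (mem_chart_source E (f x)) p).symm

variable (ρ) in
/-- The map `f_*` of the total space of the associated bundle. -/
def assocMap (p : TotalSpace F (AssocFiber ρ : M → Type _)) :
    TotalSpace F (AssocFiber ρ : M → Type _) := ⟨f p.1, p.2.map f⟩

theorem assocMap_refl (p : TotalSpace F (AssocFiber ρ : M → Type _)) :
    assocMap ρ (Diffeomorph.refl 𝓘(ℝ, E) M ∞) p = p := by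
  obtain ⟨x, ⟨⟨ξ⟩, v⟩⟩ := p; rfl

theorem assocMap_trans (f g : Diffeomorph 𝓘(ℝ, E) 𝓘(ℝ, E) M M ∞)
    (p : TotalSpace F (AssocFiber ρ : M → Type _)) :
    assocMap ρ (f.trans g) p = assocMap ρ g (assocMap ρ f p) := by
  obtain ⟨x, ⟨⟨ξ⟩, v⟩⟩ := p; rfl

/-! ### Smoothness of the induced map -/

open Classical in
variable (r) in
/-- The `r`-jet at `0` of the local expression of `f` at `x`, with the value `1` at the points where
the local expression is not defined. -/
def localJet (x : M) : JetGroup r E :=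
  if h : x ∈ φ.source ∧ f x ∈ ψ.source then
    JetGroup.mk r (FrameGerm.localExpr hφ hψ f h.1 h.2) else 1

theorem contMDiffOn_localJet :
    ContMDiffOn 𝓘(ℝ, E) 𝓘(ℝ, JetSpace r E) ∞ (localJet r hφ hψ f)
      (φ.source ∩ f ⁻¹' ψ.source) := by
  refine JetGroup.contMDiffOn_of_coords fun k => ?_
  have hmφ : φ ∈ IsManifold.maximalAtlas 𝓘(ℝ, E) ∞ M := IsManifold.subset_maximalAtlas hφ
  have hmψ : ψ ∈ IsManifold.maximalAtlas 𝓘(ℝ, E) ∞ M := IsManifold.subset_maximalAtlas hψ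
  have h1 : ∀ x ∈ φ.source ∩ f ⁻¹' ψ.source, ContDiffAt ℝ ∞ (ψ ∘ f ∘ φ.symm) (φ x) := by
    rintro x ⟨hx, hx'⟩
    have h := f.contMDiff.contMDiffAt.comp (φ x)
      (contMDiffAt_symm_of_mem_maximalAtlas hmφ (φ.map_source hx))
    refine contMDiffAt_iff_contDiffAt.1 (ContMDiffAt.comp (I' := 𝓘(ℝ, E)) _ ?_ h)
    rw [Function.comp_apply, φ.left_inv hx]
    exact contMDiffAt_of_mem_maximalAtlas hmψ hx'
  have h2 : ContMDiffOn 𝓘(ℝ, E) 𝓘(ℝ, E [×((k : ℕ) + 1)]→L[ℝ] E) ∞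
      (fun x => iteratedFDeriv ℝ ((k : ℕ) + 1) (ψ ∘ f ∘ φ.symm) (φ x))
      (φ.source ∩ f ⁻¹' ψ.source) := by
    intro x hx
    have h3 : ContDiffAt ℝ ∞ (iteratedFDeriv ℝ ((k : ℕ) + 1) (ψ ∘ f ∘ φ.symm)) (φ x) :=
      (h1 x hx).iteratedFDeriv_right (by exact_mod_cast le_top)
    exact ((contMDiffAt_iff_contDiffAt.2 h3).comp x
      (contMDiffAt_of_mem_maximalAtlas hmφ hx.1)).contMDiffWithinAt
  refine h2.congr fun x hx => ?_
  -- The local expression is a translate of `ψ ∘ f ∘ φ⁻¹` minus a constant.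
  rw [localJet, dif_pos ⟨hx.1, hx.2⟩, JetGroup.coords_mk]
  change iteratedFDeriv ℝ ((k : ℕ) + 1) (fun y => (ψ ∘ f ∘ φ.symm) (φ x + y) - ψ (f x)) 0 = _
  rw [iteratedFDeriv_sub_const_succ, iteratedFDeriv_comp_add_left, add_zero]

theorem trivializationAt_assocFiber_apply (x₀ : M) {x : M}
    (hx : x ∈ (chartAt E x₀).source) (p : AssocFiber ρ x) :
    trivializationAt F (AssocFiber ρ : M → Type _) x₀ ⟨x, p⟩ =
      (x, AssocFiber.equiv (chart_mem_atlas E x₀) hx p) :=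
  assocTriv_apply ρ (chart_mem_atlas E x₀) hx p

theorem contMDiff_assocMap :
    ContMDiff (𝓘(ℝ, E).prod 𝓘(ℝ, F)) (𝓘(ℝ, E).prod 𝓘(ℝ, F)) ∞
      (assocMap ρ f : TotalSpace F (AssocFiber ρ : M → Type _) → _) := by
  intro p₀
  have hproj := (contMDiff_proj (n := ∞) (IB := 𝓘(ℝ, E)) (F := F)
    (AssocFiber ρ : M → Type _)).contMDiffAt (x := p₀)
  refine contMDiffAt_totalSpace.2 ⟨f.contMDiff.contMDiffAt.comp p₀ hproj, ?_⟩
  have hU : (chartAt E p₀.1).source ∩ f ⁻¹' (chartAt E (f p₀.1)).source ∈ 𝓝 p₀.1 :=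
    inter_mem (chart_source_mem_nhds E p₀.1)
      (f.continuous.continuousAt (chart_source_mem_nhds E (f p₀.1)))
  have hJ := (Units.contMDiff_val.comp ρ.contMDiff_toFun).contMDiffAt.comp p₀.1
    ((contMDiffOn_localJet (r := r) (chart_mem_atlas E p₀.1)
      (chart_mem_atlas E (f p₀.1)) f).contMDiffAt hU)
  have hv := (contMDiffAt_totalSpace.1 (contMDiffAt_id (n := ∞)
    (I := 𝓘(ℝ, E).prod 𝓘(ℝ, F)) (x := p₀))).2
  refine ((hJ.comp p₀ hproj).clm_apply hv).congr_of_eventuallyEq ?_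
  filter_upwards [hproj.continuousAt.eventually hU] with p hp
  obtain ⟨x, p⟩ := p
  have hx : x ∈ (chartAt E p₀.1).source := hp.1
  have hx' : f x ∈ (chartAt E (f p₀.1)).source := hp.2
  change (trivializationAt F (AssocFiber ρ : M → Type _) (f p₀.1) ⟨f x, p.map f⟩).2 =
    ρ.op (localJet r (chart_mem_atlas E p₀.1) (chart_mem_atlas E (f p₀.1)) f x)
      (trivializationAt F (AssocFiber ρ : M → Type _) p₀.1 ⟨x, p⟩).2
  rw [trivializationAt_assocFiber_apply _ hx', trivializationAt_assocFiber_apply _ hx,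
    AssocFiber.equiv_map (chart_mem_atlas E p₀.1) (chart_mem_atlas E (f p₀.1)) f hx hx',
    localJet, dif_pos ⟨hx, hx'⟩]

variable (ρ) in
/-- The automorphism `f_*` of the associated bundle induced by the diffeomorphism `f`. -/
def assocAut : BundleAut E F (AssocFiber ρ : M → Type _) where
  toDiffeomorph :=
    { toFun := assocMap ρ f
      invFun := assocMap ρ f.symm
      left_inv := fun p => by rw [← assocMap_trans, f.self_trans_symm, assocMap_refl]
      right_inv := fun p => by rw [← assocMap_trans, f.symm_trans_self, assocMap_refl]
      contMDiff_toFun := contMDiff_assocMap f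
      contMDiff_invFun := contMDiff_assocMap f.symm }
  linear x := by
    obtain ⟨A, hA⟩ := AssocFiber.exists_linearEquiv_eq_map (ρ := ρ) (x := x) f
    exact ⟨f x, A, fun v => congrArg (TotalSpace.mk (f x)) (hA v).symm⟩

theorem baseHom_assocAut :
    BundleAut.baseHom E F (AssocFiber ρ : M → Type _) (assocAut ρ f) = f :=
  Diffeomorph.ext fun _ => rfl

end Associated

end JetBundle

end

theorem mainTheorem5 (n m r : ℕ) {M : Type*} [TopologicalSpace M] [T2Space M]
    [SecondCountableTopology M] [ConnectedSpace M] [ChartedSpace (EuclideanSpace ℝ (Fin n)) M]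
    [IsManifold (𝓡 n) ∞ M]
    (lam : JetBundle.JetRep r (EuclideanSpace ℝ (Fin n)) (EuclideanSpace ℝ (Fin m))) :
    Function.Surjective
      (JetBundle.BundleAut.baseHom (EuclideanSpace ℝ (Fin n)) (EuclideanSpace ℝ (Fin m))
        (JetBundle.AssocFiber (M := M) lam)) := by
  exact fun f => ⟨JetBundle.assocAut lam f, JetBundle.baseHom_assocAut f⟩
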